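/- **Linear stochastic bandit.** Let $\sigma,\lambda>0$, $S\ge 0$, $\delta\in(0,1)$, $d\in\mathbb N$, and let $\theta_*\in\mathbb R^d$ be an unknown parameter with Euclidean norm $\|\theta_*\|\le S$. In round $t=1,2,\dots$ the learner is given a (possibly time-varying and random) decision set $D_t$ contained in the Euclidean unit sphere of $\mathbb R^d$, plays an action $x_t\in D_t$ and observes the reward $r_t=x_t^\top\theta_*+\eta_t$. The noise is $\sigma$-sub-Gaussian given the past: there is a filtration $(\mathcal F_t)_{t\ge0}$ such that $x_t$ is $\mathcal F_{t-1}$-measurable, $\eta_t$ is $\mathcal F_t$-measurable, and for every $s\in\mathbb R$ the variable $e^{s\eta_t}$ is integrable with $\mathbf E[e^{s\eta_t}\mid\mathcal F_{t-1}]\le e^{s^2\sigma^2/2}$ almost surely. Let $x_{t,*}\in\arg\max_{x\in D_t}x^\top\theta_*$ and $$\mathrm{Regret}_T=\sum_{t=1}^T\left(x_{t,*}^\top\theta_*-x_t^\top\theta_*\right).$$ **Regret balancing applied to actions.** Put $V_t=\lambda I+\sum_{k=1}^{t-1}x_kx_k^\top$, $\|z\|_V=\sqrt{z^\top Vz}$,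 $\widehat\theta_t=V_t^{-1}\sum_{k=1}^{t-1}x_kr_k$ and $$\beta_t(\delta)=\sigma\sqrt{\log\left(\frac{\det(V_t)^{1/2}\det(\lambda I)^{-1/2}}{\delta}\right)}+\lambda^{1/2}S .$$ Let $b_t=\max_{x\in D_t}\left(x^\top\widehat\theta_t+\beta_t(\delta)\|x\|_{V_t^{-1}}\right)$ be the optimistic value. In round $t$ play $$x_t\in\arg\min_{x\in D_t}\frac{b_t-x^\top\widehat\theta_t}{\|x\|_{V_t^{-1}}^2},$$ with ties broken in any way. All of these maxima and minima are assumed to be attained (as they are for nonempty compact $D_t$). **Theorem.** There are absolute constants $C>0$ and $k\in\mathbb N$ such that in every such problem, with probability at least $1-\delta$, for all $T\ge 0$ simultaneously, $$\mathrm{Regret}_T\le C\left(\sigma+(1+\sqrt\lambda)S\right)d^{3/2}\sqrt T\,\log^k\left(2+T+d+\tfrac1\lambda+\tfrac1\delta\right).$$ In particular, for fixed $\sigma,S,\lambda$, $\mathrm{Regret}_T=\widetilde O(d^{3/2}\sqrt T)$, where $\widetilde O$ hides factors polylogarithmic in $T$, $d$ and $1/\delta$. -/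

import Mathlib

open MeasureTheory ProbabilityTheory

namespace LinearBandit

/-- The ambient Euclidean space `ℝ^d` of actions and parameters. -/
abbrev Vec (d : ℕ) := EuclideanSpace ℝ (Fin d)

/-- The weighted norm `‖z‖_M = √(zᵀ M z)`. -/
noncomputable def wnorm {d : ℕ} (M : Matrix (Fin d) (Fin d) ℝ) (z : Vec d) : ℝ :=
  √(z.ofLp ⬝ᵥ M.mulVec z.ofLp)

/-- The empirical covariance matrix `V_t = λ I + ∑_{k < t} x_k x_kᵀ` of the actions played
before round `t`; rounds are numbered from `0`, so exactly `t` rounds precede round `t`. -/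
noncomputable def covMatrix {d : ℕ} (lam : ℝ) (x : ℕ → Vec d) (t : ℕ) :
    Matrix (Fin d) (Fin d) ℝ :=
  lam • (1 : Matrix (Fin d) (Fin d) ℝ)
    + ∑ k ∈ Finset.range t, Matrix.vecMulVec (x k).ofLp (x k).ofLp

/-- The regularized least-squares estimate `V_t⁻¹ ∑_{k < t} r_k x_k` computed from the actions
`x` and the observed rewards `r` before round `t`. -/
noncomputable def lsEstimate {d : ℕ} (lam : ℝ) (x : ℕ → Vec d) (r : ℕ → ℝ) (t : ℕ) : Vec d :=
  WithLp.toLp 2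
    ((covMatrix lam x t)⁻¹.mulVec (∑ k ∈ Finset.range t, r k • (x k).ofLp))

/-- The confidence radius
`β_t(δ) = σ √(log (det(V_t)^{1/2} det(λ I)^{-1/2} / δ)) + λ^{1/2} S`. -/
noncomputable def confRadius {d : ℕ} (σ S lam δ : ℝ) (x : ℕ → Vec d) (t : ℕ) : ℝ :=
  σ * √(Real.log (√((covMatrix lam x t).det)
      * (√((lam • (1 : Matrix (Fin d) (Fin d) ℝ)).det))⁻¹ / δ)) + √lam * S

/-- The upper confidence value `zᵀ θ̂_t + β_t(δ) ‖z‖_{V_t⁻¹}` of an action `z` in round `t`. -/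
noncomputable def ucbValue {d : ℕ} (σ S lam δ : ℝ) (x : ℕ → Vec d) (r : ℕ → ℝ) (t : ℕ)
    (z : Vec d) : ℝ :=
  inner ℝ z (lsEstimate lam x r t)
    + confRadius σ S lam δ x t * wnorm (covMatrix lam x t)⁻¹ z

/-- The empirical regret `(b - zᵀ θ̂_t) / ‖z‖²_{V_t⁻¹}` of an action `z` in round `t`, relative to
the optimistic value `b`. -/
noncomputable def empRegret {d : ℕ} (lam : ℝ) (x : ℕ → Vec d) (r : ℕ → ℝ) (t : ℕ)
    (b : ℝ) (z : Vec d) : ℝ :=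
  (b - inner ℝ z (lsEstimate lam x r t)) / wnorm (covMatrix lam x t)⁻¹ z ^ 2

/-- The actions `x`, with observed rewards `r`, are played by the regret balancing strategy on the
decision sets `D`: in each round `t` there is an optimistic choice `u` (a maximizer over `D t` of
the upper confidence value, whose value is `b_t`), and `x t` minimizes over `D t` the empirical
regret relative to `b_t`. Ties may be broken in any way. -/
def IsRegretBalancing {d : ℕ} (σ S lam δ : ℝ) (D : ℕ → Set (Vec d))
    (x : ℕ → Vec d) (r : ℕ → ℝ) : Prop :=
  ∀ t, x t ∈ D t ∧ ∃ u ∈ D t, IsMaxOn (ucbValue σ S lam δ x r t) (D t) u ∧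
    IsMinOn (empRegret lam x r t (ucbValue σ S lam δ x r t u)) (D t) (x t)

/-- `η` is a `σ`-sub-Gaussian noise sequence relative to the filtration `ℱ`, where `ℱ t` is the
information available when the action of round `t` is chosen: `η t` is known from the next round
on, and `E[exp (s η_t) | ℱ t] ≤ exp (s² σ² / 2)` almost surely, for every real `s`. -/
def IsSubGaussianNoise {Ω : Type*} {mΩ : MeasurableSpace Ω} (μ : Measure Ω)
    (ℱ : Filtration ℕ mΩ) (σ : ℝ) (η : ℕ → Ω → ℝ) : Prop :=
  ∀ t, Measurable[ℱ (t + 1)] (η t) ∧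
    ∀ s : ℝ, Integrable (fun ω => Real.exp (s * η t ω)) μ ∧
      μ[fun ω => Real.exp (s * η t ω) | ℱ t] ≤ᵐ[μ] fun _ => Real.exp (s ^ 2 * σ ^ 2 / 2)

/-- `Regret_T`, the sum of `x_{t,*}ᵀ θ - x_tᵀ θ` over the first `T` rounds. -/
noncomputable def regret {d : ℕ} (θ : Vec d) (xstar x : ℕ → Vec d) (T : ℕ) : ℝ :=
  ∑ t ∈ Finset.range T, (inner ℝ (xstar t) θ - inner ℝ (x t) θ)

end LinearBandit

namespace LinearBandit

open Matrix
open scoped ENNReal NNReal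

/-! ### Quadratic forms, determinants and rank one updates. -/

section LinearAlgebra

variable {n : Type*} [Fintype n] [DecidableEq n]

/-! Concentration. The method of mixtures turns the noise into a nonnegative supermartingale,
exp(‖S_t‖²/(2σ²)) / √(det V_t / λ^d), where S_t = ∑ η_k x_k is measured in the V_t⁻¹-norm. Ville's
inequality bounds all S_t at once, off an event of probability at most δ
(`measure_exists_lt_invSq_noiseSum_le`). The d-dimensional Gaussian mixture is never formed: one
step of it only involves the law of a scalar ⟨x_t, ·⟩, so each increment is a one-dimensional
Gaussian average.

This argument gives the deviation σ√(2 log ...), whereas β_t has no factor 2. Hence estimates are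
only accurate up to √2 β_t times the width, and b_t may fall below the optimal value. The ratio rule
makes up for this (`gap_le_of_ratio_le`): if the optimal action violates optimism, its ratio is
small, and since the played ratio is smaller still, its width is at most √2 times the played width,
so the violation is affordable. Comparison with the optimistic action, whose ratio is β_t divided by
its width and hence at most β_t √(λ+t), bounds the regret of a round by 3 β_t √(λ+t) w_t with w_t =
‖x_t‖² in the V_t⁻¹-norm.

Summation. ∑ log(1+w_t) is exactly log(det V_T / λ^d), at most d log(1+T/λ). With β_T of order √d
and √(λ+T) of order √T, this gives d^{3/2} √T up to logarithms. -/

lemma dotProduct_mulVec_comm_of_isHermitian {n : Type*} [Fintype n] {M : Matrix n n ℝ}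
    (hM : M.IsHermitian) (u v : n → ℝ) : u ⬝ᵥ M *ᵥ v = v ⬝ᵥ M *ᵥ u := by
  rw [dotProduct_mulVec, ← mulVec_transpose, dotProduct_comm]
  congr 2

/-- The Cauchy-Schwarz inequality for the form `uᵀ M v` of a positive semidefinite matrix. -/
lemma sq_dotProduct_mulVec_le {M : Matrix n n ℝ} (hM : M.PosSemidef) (u v : n → ℝ) :
    (u ⬝ᵥ M *ᵥ v) ^ 2 ≤ (u ⬝ᵥ M *ᵥ u) * (v ⬝ᵥ M *ᵥ v) := by
  have h := LinearMap.BilinForm.apply_sq_le_of_symm (Matrix.toBilin' M)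
    (fun z => by
      rw [Matrix.toBilin'_apply']
      simpa using hM.dotProduct_mulVec_nonneg z)
    ⟨fun a b => by
      simp only [Matrix.toBilin'_apply', RingHom.id_apply]
      exact dotProduct_mulVec_comm_of_isHermitian hM.1 a b⟩ u v
  simpa only [Matrix.toBilin'_apply'] using h

lemma det_add_vecMulVec_self {V : Matrix n n ℝ} (hV : IsUnit V.det) (x : n → ℝ) :
    (V + vecMulVec x x).det = V.det * (1 + x ⬝ᵥ V⁻¹ *ᵥ x) := by
  rw [vecMulVec_eq Unit, det_add_replicateCol_mul_replicateRow hV,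
    det_unique (1 + replicateRow Unit x * V⁻¹ * replicateCol Unit x), Matrix.add_apply,
    Matrix.one_apply_eq, Matrix.mul_assoc, ← replicateCol_mulVec,
    replicateRow_mul_replicateCol_apply]

/-- The effect of a rank one update of `V` on the quadratic form of its inverse. -/
lemma dotProduct_inv_mulVec_rank_one_update {V : Matrix n n ℝ} (hV : V.PosDef)
    (x s : n → ℝ) (e : ℝ) :
    (s + e • x) ⬝ᵥ (V + vecMulVec x x)⁻¹ *ᵥ (s + e • x) = s ⬝ᵥ V⁻¹ *ᵥ s +
      (2 * e * (x ⬝ᵥ V⁻¹ *ᵥ s) + e ^ 2 * (x ⬝ᵥ V⁻¹ *ᵥ x) - (x ⬝ᵥ V⁻¹ *ᵥ s) ^ 2)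
        / (1 + x ⬝ᵥ V⁻¹ *ᵥ x) := by
  have hV' : (V + vecMulVec x x).PosDef :=
    hV.add_posSemidef (by simpa using posSemidef_vecMulVec_self_star x)
  have hdet : IsUnit V.det := (isUnit_iff_isUnit_det V).1 hV.isUnit
  have hdet' : IsUnit (V + vecMulVec x x).det := (isUnit_iff_isUnit_det _).1 hV'.isUnit
  have hsymm : s ⬝ᵥ V⁻¹ *ᵥ x = x ⬝ᵥ V⁻¹ *ᵥ s :=
    dotProduct_mulVec_comm_of_isHermitian hV.inv.1 s x
  have hw : 0 ≤ x ⬝ᵥ V⁻¹ *ᵥ x := by simpa using hV.inv.posSemidef.dotProduct_mulVec_nonneg x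
  set w := x ⬝ᵥ V⁻¹ *ᵥ x with hwdef
  set a := x ⬝ᵥ V⁻¹ *ᵥ s with hadef
  -- Sherman-Morrison as a linear system: on the ansatz V⁻¹s + c V⁻¹x, matching the coefficients of
  -- x gives c(1 + w) + a = e.
  have hsol : (V + vecMulVec x x) *ᵥ (V⁻¹ *ᵥ s + ((e - a) / (1 + w)) • V⁻¹ *ᵥ x) = s + e • x := by
    have h1 : V *ᵥ (V⁻¹ *ᵥ s) = s := by
      rw [mulVec_mulVec, mul_nonsing_inv _ hdet, one_mulVec]
    have h2 : V *ᵥ (V⁻¹ *ᵥ x) = x := by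
      rw [mulVec_mulVec, mul_nonsing_inv _ hdet, one_mulVec]
    rw [add_mulVec, mulVec_add, mulVec_smul, h1, h2, vecMulVec_mulVec, dotProduct_add,
      dotProduct_smul, ← hwdef, ← hadef]
    ext i
    simp only [Pi.add_apply, Pi.smul_apply, smul_eq_mul, MulOpposite.smul_eq_mul_unop,
      MulOpposite.unop_op]
    field_simp
    ring
  have hinv : (V + vecMulVec x x)⁻¹ *ᵥ (s + e • x)
      = V⁻¹ *ᵥ s + ((e - a) / (1 + w)) • V⁻¹ *ᵥ x := by
    rw [← hsol, mulVec_mulVec, nonsing_inv_mul _ hdet', one_mulVec]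
  rw [hinv]
  simp only [add_dotProduct, dotProduct_add, smul_dotProduct, dotProduct_smul, smul_eq_mul, hsymm,
    ← hwdef, ← hadef]
  field_simp
  ring

/-- A unit vector has `V⁻¹`-norm at least `c^{-1/2}` when `V ≤ c`. -/
lemma one_le_mul_dotProduct_inv_mulVec {V : Matrix n n ℝ} (hV : V.PosDef) {c : ℝ}
    {z : n → ℝ} (hz : z ⬝ᵥ z = 1) (hc : z ⬝ᵥ V *ᵥ z ≤ c) : 1 ≤ c * (z ⬝ᵥ V⁻¹ *ᵥ z) := by
  have hdet : IsUnit V.det := (isUnit_iff_isUnit_det V).1 hV.isUnit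
  have hw : 0 ≤ z ⬝ᵥ V⁻¹ *ᵥ z := by simpa using hV.inv.posSemidef.dotProduct_mulVec_nonneg z
  -- Cauchy-Schwarz for V⁻¹ applied to z and Vz reads (z·z)² ≤ (zᵀV⁻¹z)(zᵀVz).
  have h := sq_dotProduct_mulVec_le hV.inv.posSemidef z (V *ᵥ z)
  rw [mulVec_mulVec, nonsing_inv_mul _ hdet, one_mulVec, hz, dotProduct_comm (V *ᵥ z)] at h
  nlinarith

/-- Each eigenvalue is the Rayleigh quotient of a unit eigenvector, hence at most c, and the
determinant is their product. -/
lemma det_le_pow_of_forall_dotProduct_mulVec_le {V : Matrix n n ℝ} (hV : V.PosSemidef) {c : ℝ}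
    (hc : ∀ z : n → ℝ, z ⬝ᵥ V *ᵥ z ≤ c * (z ⬝ᵥ z)) : V.det ≤ c ^ Fintype.card n := by
  rw [hV.1.det_eq_prod_eigenvalues, ← Finset.card_univ, ← Finset.prod_const]
  refine Finset.prod_le_prod (fun i _ => by simpa using hV.eigenvalues_nonneg i) fun i _ => ?_
  have h := hc (hV.1.eigenvectorBasis i).ofLp
  have h1 : (hV.1.eigenvectorBasis i).ofLp ⬝ᵥ (hV.1.eigenvectorBasis i).ofLp = 1 := by
    have := hV.1.eigenvectorBasis.orthonormal.1 i
    rw [EuclideanSpace.norm_eq, Real.sqrt_eq_one] at this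
    rw [← this]
    simp [dotProduct, sq]
  have h2 := hV.1.eigenvalues_eq i
  rw [h1] at h
  simpa [h2] using h

end LinearAlgebra

/-! ### The covariance matrix and its log-determinant. -/

section CovMatrix

variable {d : ℕ} {lam : ℝ}

lemma posDef_covMatrix (hlam : 0 < lam) (x : ℕ → Vec d) (t : ℕ) :
    (covMatrix lam x t).PosDef :=
  (Matrix.PosDef.one.smul hlam).add_posSemidef
    (Matrix.posSemidef_sum _ fun k _ => by simpa using posSemidef_vecMulVec_self_star (x k).ofLp)

lemma covMatrix_succ (lam : ℝ) (x : ℕ → Vec d) (t : ℕ) :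
    covMatrix lam x (t + 1) = covMatrix lam x t + vecMulVec (x t).ofLp (x t).ofLp := by
  rw [covMatrix, Finset.sum_range_succ, ← add_assoc, covMatrix]

lemma covMatrix_zero (lam : ℝ) (x : ℕ → Vec d) : covMatrix lam x 0 = lam • 1 := by
  simp [covMatrix]

lemma isUnit_det_covMatrix (hlam : 0 < lam) (x : ℕ → Vec d) (t : ℕ) :
    IsUnit (covMatrix lam x t).det :=
  (isUnit_iff_isUnit_det _).1 (posDef_covMatrix hlam x t).isUnit

/-- The squared weighted norm `‖z‖²` with respect to `V_t⁻¹`. -/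
noncomputable def invSq (lam : ℝ) (x : ℕ → Vec d) (t : ℕ) (z : Fin d → ℝ) : ℝ :=
  z ⬝ᵥ (covMatrix lam x t)⁻¹ *ᵥ z

lemma invSq_nonneg (hlam : 0 < lam) (x : ℕ → Vec d) (t : ℕ) (z : Fin d → ℝ) :
    0 ≤ invSq lam x t z := by
  simpa [invSq] using (posDef_covMatrix hlam x t).inv.posSemidef.dotProduct_mulVec_nonneg z

lemma invSq_pos (hlam : 0 < lam) (x : ℕ → Vec d) (t : ℕ) {z : Fin d → ℝ} (hz : z ≠ 0) :
    0 < invSq lam x t z := by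
  simpa [invSq] using (posDef_covMatrix hlam x t).inv.dotProduct_mulVec_pos hz

lemma wnorm_inv_covMatrix (lam : ℝ) (x : ℕ → Vec d) (t : ℕ) (z : Vec d) :
    wnorm (covMatrix lam x t)⁻¹ z = √(invSq lam x t z.ofLp) := rfl

lemma det_covMatrix_succ (hlam : 0 < lam) (x : ℕ → Vec d) (t : ℕ) :
    (covMatrix lam x (t + 1)).det = (covMatrix lam x t).det * (1 + invSq lam x t (x t).ofLp) := by
  rw [covMatrix_succ, det_add_vecMulVec_self (isUnit_det_covMatrix hlam x t), invSq]

lemma dotProduct_self_ofLp (z : Vec d) : z.ofLp ⬝ᵥ z.ofLp = ‖z‖ ^ 2 := by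
  rw [EuclideanSpace.norm_sq_eq]
  simp [dotProduct, sq]

lemma inner_eq_dotProduct (y z : Vec d) : inner ℝ y z = y.ofLp ⬝ᵥ z.ofLp := by
  rw [EuclideanSpace.inner_eq_star_dotProduct, dotProduct_comm]
  simp

lemma covMatrix_mulVec (lam : ℝ) (x : ℕ → Vec d) (t : ℕ) (z : Fin d → ℝ) :
    covMatrix lam x t *ᵥ z
      = lam • z + ∑ k ∈ Finset.range t, ((x k).ofLp ⬝ᵥ z) • (x k).ofLp := by
  rw [covMatrix, add_mulVec, smul_mulVec, one_mulVec, sum_mulVec]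
  simp [vecMulVec_mulVec]

lemma dotProduct_covMatrix_mulVec_le {x : ℕ → Vec d} (hx : ∀ t, ‖x t‖ = 1) (t : ℕ)
    (z : Fin d → ℝ) : z ⬝ᵥ covMatrix lam x t *ᵥ z ≤ (lam + t) * (z ⬝ᵥ z) := by
  rw [covMatrix_mulVec, dotProduct_add, dotProduct_smul, dotProduct_sum, add_mul, smul_eq_mul]
  gcongr
  refine (Finset.sum_le_card_nsmul _ _ (z ⬝ᵥ z) fun k _ => ?_).trans (by simp)
  rw [dotProduct_smul, dotProduct_comm z, smul_eq_mul, ← sq]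
  have h := sq_dotProduct_mulVec_le (Matrix.PosSemidef.one (n := Fin d) (R := ℝ)) (x k).ofLp z
  simpa [dotProduct_self_ofLp, hx] using h

lemma det_covMatrix_le (hlam : 0 < lam) {x : ℕ → Vec d} (hx : ∀ t, ‖x t‖ = 1) (t : ℕ) :
    (covMatrix lam x t).det ≤ (lam + t) ^ d := by
  simpa using det_le_pow_of_forall_dotProduct_mulVec_le (posDef_covMatrix hlam x t).posSemidef
    (dotProduct_covMatrix_mulVec_le hx t)

/-- Unit actions keep V_t below λ + t, so no width shrinks faster than (λ+t)^{-1/2}. This is what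
bounds the ratio of the optimistic action. -/
lemma one_le_mul_invSq (hlam : 0 < lam) {x : ℕ → Vec d} (hx : ∀ t, ‖x t‖ = 1) (t : ℕ)
    {z : Vec d} (hz : ‖z‖ = 1) : 1 ≤ (lam + t) * invSq lam x t z.ofLp := by
  have hz' : z.ofLp ⬝ᵥ z.ofLp = 1 := by rw [dotProduct_self_ofLp, hz, one_pow]
  refine one_le_mul_dotProduct_inv_mulVec (posDef_covMatrix hlam x t) hz' ?_
  simpa [hz'] using dotProduct_covMatrix_mulVec_le (lam := lam) hx t z.ofLp

/-- The logarithm of `det V_t / det (λ I)`. -/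
noncomputable def logDetRatio (lam : ℝ) (x : ℕ → Vec d) (t : ℕ) : ℝ :=
  Real.log ((covMatrix lam x t).det / lam ^ d)

/-- The elliptical potential as an exact identity: the matrix determinant lemma telescopes. -/
lemma logDetRatio_eq_sum (hlam : 0 < lam) (x : ℕ → Vec d) (t : ℕ) :
    logDetRatio lam x t
      = ∑ k ∈ Finset.range t, Real.log (1 + invSq lam x k (x k).ofLp) := by
  induction t with
  | zero => simp [logDetRatio, covMatrix_zero, hlam.ne']
  | succ t ih =>
    have h1 := (posDef_covMatrix hlam x t).det_pos
    have h2 := invSq_nonneg hlam x t (x t).ofLp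
    rw [Finset.sum_range_succ, ← ih, logDetRatio, logDetRatio, det_covMatrix_succ hlam,
      mul_div_right_comm, Real.log_mul (by positivity) (by positivity)]

lemma logDetRatio_mono (hlam : 0 < lam) (x : ℕ → Vec d) : Monotone (logDetRatio lam x) := by
  refine monotone_nat_of_le_succ fun t => ?_
  rw [logDetRatio_eq_sum hlam, logDetRatio_eq_sum hlam, Finset.sum_range_succ]
  have := Real.log_nonneg (show 1 ≤ 1 + invSq lam x t (x t).ofLp by
    linarith [invSq_nonneg hlam x t (x t).ofLp])
  linarith

lemma logDetRatio_le (hlam : 0 < lam) {x : ℕ → Vec d} (hx : ∀ t, ‖x t‖ = 1) (t : ℕ) :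
    logDetRatio lam x t ≤ d * Real.log (1 + t / lam) := by
  have h1 := (posDef_covMatrix hlam x t).det_pos
  rw [← Real.log_pow, logDetRatio]
  refine Real.log_le_log (by positivity) ?_
  have h2 : (1 + t / lam) * lam = lam + t := by field_simp
  rw [div_le_iff₀ (by positivity), ← mul_pow, h2]
  exact det_covMatrix_le hlam hx t

lemma confRadius_eq (hlam : 0 < lam) {σ S δ : ℝ} (hδ : 0 < δ) (x : ℕ → Vec d) (t : ℕ) :
    confRadius σ S lam δ x t
      = σ * √(logDetRatio lam x t / 2 + Real.log (1 / δ)) + √lam * S := by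
  have h1 := (posDef_covMatrix hlam x t).det_pos
  have h2 : 0 < lam ^ d := by positivity
  have h3 : (lam • (1 : Matrix (Fin d) (Fin d) ℝ)).det = lam ^ d := by simp
  rw [confRadius, h3, ← Real.sqrt_inv, ← Real.sqrt_mul h1.le, ← div_eq_mul_inv, div_eq_mul_one_div,
    Real.log_mul (by positivity) (by positivity), Real.log_sqrt (by positivity), logDetRatio]

end CovMatrix

/-! ### Conditional Gaussian mixtures and Ville's inequality. -/

section Supermartingale

variable {Ω : Type*} {m mΩ : MeasurableSpace Ω} {μ : Measure Ω}

/-- A bound on a conditional expectation given `m`, integrated against an `m`-measurable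
nonnegative function. -/
lemma lintegral_ofReal_mul_le_of_condExp_le [IsFiniteMeasure μ] (hm : m ≤ mΩ) {f : Ω → ℝ}
    (hf : Integrable f μ) (hf0 : ∀ ω, 0 ≤ f ω) {c : ℝ} (h : μ[f | m] ≤ᵐ[μ] fun _ => c)
    {g : Ω → ℝ≥0∞} (hg : Measurable[m] g) :
    ∫⁻ ω, ENNReal.ofReal (f ω) * g ω ∂μ ≤ ENNReal.ofReal c * ∫⁻ ω, g ω ∂μ := by
  -- The bound is first proved as an inequality of measures on `m`, by testing on `m`-measurable
  -- sets. Integrating `g` against it then needs no integrability of `g`.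
  have hle : (μ.withDensity fun ω => ENNReal.ofReal (f ω)).trim hm
      ≤ (ENNReal.ofReal c • μ).trim hm := by
    refine Measure.le_iff.2 fun A hA => ?_
    rw [trim_measurableSet_eq hm hA, trim_measurableSet_eq hm hA, withDensity_apply _ (hm A hA),
      ← ofReal_integral_eq_lintegral_ofReal hf.integrableOn (ae_of_all _ hf0),
      ← setIntegral_condExp hm hf hA, Measure.smul_apply, smul_eq_mul]
    have hle' : ∫ ω in A, (μ[f | m]) ω ∂μ ≤ ∫ _ in A, c ∂μ :=
      integral_mono_ae integrable_condExp.integrableOn (integrable_const c)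
        (ae_restrict_of_ae h)
    refine (ENNReal.ofReal_le_ofReal hle').trans ?_
    rw [setIntegral_const, smul_eq_mul, mul_comm]
    by_cases hc : 0 ≤ c
    · rw [ENNReal.ofReal_mul hc, ofReal_measureReal]
    · rw [ENNReal.ofReal_of_nonpos (mul_nonpos_of_nonpos_of_nonneg (not_le.1 hc).le
        measureReal_nonneg)]
      exact zero_le
  have h1 : ∫⁻ ω, ENNReal.ofReal (f ω) * g ω ∂μ
      = ∫⁻ ω, g ω ∂(μ.withDensity fun ω => ENNReal.ofReal (f ω)).trim hm := by
    rw [lintegral_trim hm hg, lintegral_withDensity_eq_lintegral_mul₀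
      hf.aestronglyMeasurable.aemeasurable.ennreal_ofReal (hg.mono hm le_rfl).aemeasurable]
    rfl
  rw [h1]
  refine (lintegral_mono' hle le_rfl).trans ?_
  rw [lintegral_trim hm hg, lintegral_smul_measure, smul_eq_mul]

/-- Mixing the exponentials `exp (s e - s² σ² / 2)` over a Gaussian `s`. -/
lemma ofReal_exp_eq_lintegral_gaussianPDF {σ w : ℝ} (hσ : 0 < σ) (hw : 0 < w) (a e : ℝ) :
    ENNReal.ofReal (Real.exp ((2 * e * a + e ^ 2 * w - a ^ 2) / (1 + w) / (2 * σ ^ 2)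
        - Real.log (1 + w) / 2))
      = ∫⁻ s, ENNReal.ofReal (Real.exp (s * e)) * (ENNReal.ofReal (Real.exp (-(s ^ 2 * σ ^ 2 / 2)))
          * gaussianPDF (a / σ ^ 2) (w / σ ^ 2).toNNReal s) := by
  set K := (2 * e * a + e ^ 2 * w - a ^ 2) / (1 + w) / (2 * σ ^ 2) - Real.log (1 + w) / 2 with hK
  have hv : 0 < w / (σ ^ 2 * (1 + w)) := by positivity
  -- Completing the square in s: the precisions σ²/w and σ² add up to σ²(1+w)/w, which gives the new
  -- variance, and the leftover constant is exp K.
  have key : ∀ s : ℝ, Real.exp (s * e) * (Real.exp (-(s ^ 2 * σ ^ 2 / 2))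
      * gaussianPDFReal (a / σ ^ 2) (w / σ ^ 2).toNNReal s) = Real.exp K *
      gaussianPDFReal ((e * w + a) / (σ ^ 2 * (1 + w))) (w / (σ ^ 2 * (1 + w))).toNNReal s := by
    intro s
    rw [gaussianPDFReal, gaussianPDFReal, Real.coe_toNNReal _ hv.le,
      Real.coe_toNNReal _ (by positivity)]
    have h1 : Real.exp (-(Real.log (1 + w) / 2)) = (√(1 + w))⁻¹ := by
      rw [Real.exp_neg, ← Real.log_sqrt (by positivity), Real.exp_log (by positivity)]
    have h2 : √(2 * Real.pi * (w / σ ^ 2))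
        = √(1 + w) * √(2 * Real.pi * (w / (σ ^ 2 * (1 + w)))) := by
      rw [← Real.sqrt_mul (by positivity)]
      congr 1
      field_simp
    have h3 : s * e + (-(s ^ 2 * σ ^ 2 / 2) + -(s - a / σ ^ 2) ^ 2 / (2 * (w / σ ^ 2)))
        = (2 * e * a + e ^ 2 * w - a ^ 2) / (1 + w) / (2 * σ ^ 2)
          + -(s - (e * w + a) / (σ ^ 2 * (1 + w))) ^ 2 / (2 * (w / (σ ^ 2 * (1 + w)))) := by
      field_simp
      ring
    have h4 := congrArg Real.exp h3
    rw [Real.exp_add, Real.exp_add, Real.exp_add] at h4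
    have h5 : Real.exp K = Real.exp ((2 * e * a + e ^ 2 * w - a ^ 2) / (1 + w) / (2 * σ ^ 2))
        * (√(1 + w))⁻¹ := by
      rw [hK, sub_eq_add_neg, Real.exp_add, h1]
    rw [h5, h2, mul_inv]
    linear_combination ((√(1 + w))⁻¹ * (√(2 * Real.pi * (w / (σ ^ 2 * (1 + w)))))⁻¹) * h4
  have key' : ∀ s : ℝ, ENNReal.ofReal (Real.exp (s * e))
        * (ENNReal.ofReal (Real.exp (-(s ^ 2 * σ ^ 2 / 2)))
          * gaussianPDF (a / σ ^ 2) (w / σ ^ 2).toNNReal s)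
      = ENNReal.ofReal (Real.exp K) * gaussianPDF ((e * w + a) / (σ ^ 2 * (1 + w)))
          (w / (σ ^ 2 * (1 + w))).toNNReal s := by
    intro s
    rw [gaussianPDF, gaussianPDF, ← ENNReal.ofReal_mul (Real.exp_nonneg _),
      ← ENNReal.ofReal_mul (Real.exp_nonneg _), ← ENNReal.ofReal_mul (Real.exp_nonneg _), key]
  simp_rw [key']
  rw [lintegral_const_mul _ (measurable_gaussianPDF _ _), lintegral_gaussianPDF_eq_one _
    (by simpa using hv), mul_one]

/-- The conditional form of the method of mixtures with predictable Gaussian weights. -/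
lemma lintegral_exp_mixture_mul_le [IsProbabilityMeasure μ] (hm : m ≤ mΩ) {σ : ℝ} (hσ : 0 < σ)
    {η : Ω → ℝ} (hη : Measurable η)
    (hsub : ∀ s : ℝ, Integrable (fun ω => Real.exp (s * η ω)) μ ∧
      μ[fun ω => Real.exp (s * η ω) | m] ≤ᵐ[μ] fun _ => Real.exp (s ^ 2 * σ ^ 2 / 2))
    {a w : Ω → ℝ} (ha : Measurable[m] a) (hw : Measurable[m] w) (hw0 : ∀ ω, 0 < w ω)
    {g : Ω → ℝ≥0∞} (hg : Measurable[m] g) :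
    ∫⁻ ω, ENNReal.ofReal (Real.exp ((2 * η ω * a ω + η ω ^ 2 * w ω - a ω ^ 2) / (1 + w ω)
        / (2 * σ ^ 2) - Real.log (1 + w ω) / 2)) * g ω ∂μ ≤ ∫⁻ ω, g ω ∂μ := by
  have ha' := ha.mono hm le_rfl
  have hw' := hw.mono hm le_rfl
  have hg' := hg.mono hm le_rfl
  have hpdf : Measurable fun p : Ω × ℝ =>
      gaussianPDF (a p.1 / σ ^ 2) (w p.1 / σ ^ 2).toNNReal p.2 :=
    measurable_uncurry_gaussianPDF.comp
      (((ha'.comp measurable_fst).div_const _).prodMk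
        (((hw'.comp measurable_fst).div_const _).real_toNNReal.prodMk measurable_snd))
  have hpdf_left : ∀ s, Measurable[m] fun ω =>
      gaussianPDF (a ω / σ ^ 2) (w ω / σ ^ 2).toNNReal s := fun s =>
    measurable_uncurry_gaussianPDF.comp
      ((ha.div_const _).prodMk ((hw.div_const _).real_toNNReal.prodMk measurable_const))
  calc _ = ∫⁻ ω, (∫⁻ s : ℝ, ENNReal.ofReal (Real.exp (s * η ω))
            * (ENNReal.ofReal (Real.exp (-(s ^ 2 * σ ^ 2 / 2)))
              * gaussianPDF (a ω / σ ^ 2) (w ω / σ ^ 2).toNNReal s) * g ω) ∂μ := by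
        refine lintegral_congr fun ω => ?_
        rw [ofReal_exp_eq_lintegral_gaussianPDF hσ (hw0 ω), lintegral_mul_const]
        have := measurable_gaussianPDF (a ω / σ ^ 2) (w ω / σ ^ 2).toNNReal
        fun_prop
    _ = ∫⁻ s : ℝ, ∫⁻ ω, ENNReal.ofReal (Real.exp (s * η ω))
            * (ENNReal.ofReal (Real.exp (-(s ^ 2 * σ ^ 2 / 2)))
              * gaussianPDF (a ω / σ ^ 2) (w ω / σ ^ 2).toNNReal s) * g ω ∂μ := by
        refine lintegral_lintegral_swap (Measurable.aemeasurable ?_)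
        simp only [Function.uncurry_def]
        fun_prop
    -- For fixed s the Gaussian weight is `m`-measurable, so the conditional sub-Gaussian bound
    -- applies and exp(s²σ²/2) cancels against the compensator.
    _ ≤ ∫⁻ s : ℝ, ∫⁻ ω, gaussianPDF (a ω / σ ^ 2) (w ω / σ ^ 2).toNNReal s * g ω ∂μ := by
        refine lintegral_mono fun s => ?_
        simp_rw [mul_assoc]
        refine (lintegral_ofReal_mul_le_of_condExp_le hm (hsub s).1
          (fun ω => (Real.exp_pos _).le) (hsub s).2
          (g := fun ω => ENNReal.ofReal (Real.exp (-(s ^ 2 * σ ^ 2 / 2)))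
            * (gaussianPDF (a ω / σ ^ 2) (w ω / σ ^ 2).toNNReal s * g ω))
          (measurable_const.mul ((hpdf_left s).mul hg))).trans ?_
        rw [lintegral_const_mul _ (show Measurable fun ω =>
            gaussianPDF (a ω / σ ^ 2) (w ω / σ ^ 2).toNNReal s * g ω from
            ((hpdf_left s).mul hg).mono hm le_rfl), ← mul_assoc,
          ← ENNReal.ofReal_mul (Real.exp_nonneg _), ← Real.exp_add]
        simp
    _ = ∫⁻ ω, (∫⁻ s : ℝ, gaussianPDF (a ω / σ ^ 2) (w ω / σ ^ 2).toNNReal s * g ω) ∂μ := by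
        refine (lintegral_lintegral_swap (Measurable.aemeasurable ?_)).symm
        simp only [Function.uncurry_def]
        fun_prop
    _ = ∫⁻ ω, g ω ∂μ := by
        refine lintegral_congr fun ω => ?_
        have hv : 0 < w ω / σ ^ 2 := div_pos (hw0 ω) (by positivity)
        rw [lintegral_mul_const _ (measurable_gaussianPDF _ _),
          lintegral_gaussianPDF_eq_one _ (by simpa using hv), one_mul]

/-- **Ville's inequality** for nonnegative supermartingales with values in `ℝ≥0∞`. -/
lemma mul_measure_exists_le_lintegral_zero [IsFiniteMeasure μ] {ℱ : Filtration ℕ mΩ}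
    {Y : ℕ → Ω → ℝ≥0∞} (hY : ∀ t, Measurable[ℱ t] (Y t))
    (hsup : ∀ t A, MeasurableSet[ℱ t] A → ∫⁻ ω in A, Y (t + 1) ω ∂μ ≤ ∫⁻ ω in A, Y t ω ∂μ)
    (c : ℝ≥0∞) : c * μ {ω | ∃ t, c ≤ Y t ω} ≤ ∫⁻ ω, Y 0 ω ∂μ := by
  have hYm : ∀ t, Measurable (Y t) := fun t => (hY t).mono (ℱ.le t) le_rfl
  -- The event of no crossing strictly before time n. The strict inequality puts G (n + 1) in ℱ n,
  -- as the supermartingale step from n to n + 1 requires.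
  let G : ℕ → Set Ω := fun n => {ω | ∀ k < n, Y k ω < c}
  have hG : ∀ n, MeasurableSet[ℱ n] (G (n + 1)) := fun n => by
    have : G (n + 1) = ⋂ k ∈ Set.Iio (n + 1), {ω | Y k ω < c} := by ext; simp [G]
    rw [this]
    refine MeasurableSet.biInter (Set.to_countable _) fun k hk => ?_
    exact ℱ.mono (Nat.lt_succ_iff.1 hk) _ ((hY k) measurableSet_Iio)
  have hG' : ∀ n, MeasurableSet (G n) := fun n => by
    cases n with
    | zero => simp [G]
    | succ n => exact ℱ.le n _ (hG n)
  -- The process stopped at its first crossing, with value c there: its total mass does not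
  -- increase.
  have hind : ∀ n, ∫⁻ ω in G n, Y n ω ∂μ + c * μ (G n)ᶜ ≤ ∫⁻ ω, Y 0 ω ∂μ := by
    intro n
    induction n with
    | zero => simp [G]
    | succ n ih =>
      refine le_trans ?_ ih
      have hsub : G (n + 1) ⊆ G n := fun ω hω k hk => hω k (hk.trans n.lt_succ_self)
      have hsplit : ∫⁻ ω in G n, Y n ω ∂μ
          = ∫⁻ ω in G (n + 1), Y n ω ∂μ + ∫⁻ ω in G n \ G (n + 1), Y n ω ∂μ := by
        rw [← lintegral_union ((hG' n).diff (hG' (n + 1))) Set.disjoint_sdiff_right,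
          Set.union_sdiff_cancel hsub]
      -- On G n \ G (n + 1) the first crossing happens at time n itself.
      have hge : c * μ (G n \ G (n + 1)) ≤ ∫⁻ ω in G n \ G (n + 1), Y n ω ∂μ := by
        rw [← setLIntegral_const]
        refine setLIntegral_mono (hYm n) fun ω hω => ?_
        by_contra hlt
        refine hω.2 fun k hk => ?_
        rcases Nat.lt_succ_iff_lt_or_eq.1 hk with hk | rfl
        · exact hω.1 k hk
        · exact not_le.1 hlt
      have hcompl : μ (G (n + 1))ᶜ = μ (G n \ G (n + 1)) + μ (G n)ᶜ := by
        rw [← measure_union _ (hG' n).compl]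
        · congr 1
          ext ω
          simp only [Set.mem_compl_iff, Set.mem_union, Set.mem_sdiff]
          have := @hsub ω
          tauto
        · exact Set.disjoint_left.2 fun ω h1 h2 => h2 h1.1
      rw [hcompl, hsplit, mul_add, ← add_assoc]
      exact add_le_add (add_le_add (hsup n _ (hG n)) hge) le_rfl
  have hU : {ω | ∃ t, c ≤ Y t ω} = ⋃ n, (G n)ᶜ := by
    ext ω
    simp only [Set.mem_ofPred_eq, Set.mem_iUnion, Set.mem_compl_iff, G, not_forall, not_lt]
    exact ⟨fun ⟨t, ht⟩ => ⟨t + 1, t, t.lt_succ_self, ht⟩, fun ⟨_, k, _, hk⟩ => ⟨k, hk⟩⟩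
  have hmono : Monotone fun n => (G n)ᶜ := fun i j hij =>
    Set.compl_subset_compl.2 fun ω hω k hk => hω k (hk.trans_le hij)
  rw [hU, hmono.measure_iUnion, ENNReal.mul_iSup]
  exact iSup_le fun n => le_add_self.trans (hind n)

end Supermartingale

/-! ### The self-normalized deviation inequality. -/

section SelfNormalized

variable {d : ℕ} {lam : ℝ}

/-- The noise-weighted sum `∑_{k < t} η_k x_k` of the actions. -/
def noiseSum (x : ℕ → Vec d) (η : ℕ → ℝ) (t : ℕ) : Fin d → ℝ :=
  ∑ k ∈ Finset.range t, η k • (x k).ofLp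

/-- The logarithm of the Gaussian mixture of the exponential supermartingales of the noise. -/
noncomputable def logMixture (σ lam : ℝ) (x : ℕ → Vec d) (η : ℕ → ℝ) (t : ℕ) : ℝ :=
  invSq lam x t (noiseSum x η t) / (2 * σ ^ 2) - logDetRatio lam x t / 2

/-- The inner product of `x_t` and the noise sum with respect to `V_t⁻¹`. -/
noncomputable def noiseInner (lam : ℝ) (x : ℕ → Vec d) (η : ℕ → ℝ) (t : ℕ) : ℝ :=
  (x t).ofLp ⬝ᵥ (covMatrix lam x t)⁻¹ *ᵥ noiseSum x η t

lemma logMixture_zero (hlam : 0 < lam) (σ : ℝ) (x : ℕ → Vec d) (η : ℕ → ℝ) :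
    logMixture σ lam x η 0 = 0 := by
  rw [logMixture, logDetRatio_eq_sum hlam]
  simp [noiseSum, invSq]

/-- The increment is the exponent in `ofReal_exp_eq_lintegral_gaussianPDF` with a = `noiseInner` and
w = `invSq` of x_t. Its mixing law N(a/σ², w/σ²) is that of ⟨x_t, ·⟩ under the Gaussian
N(V_t⁻¹S_t/σ², V_t⁻¹/σ²), the mixture reweighted by the past. -/
lemma logMixture_succ (hlam : 0 < lam) (σ : ℝ) (x : ℕ → Vec d) (η : ℕ → ℝ) (t : ℕ) :
    logMixture σ lam x η (t + 1) = ((2 * η t * noiseInner lam x η t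
        + η t ^ 2 * invSq lam x t (x t).ofLp - noiseInner lam x η t ^ 2)
        / (1 + invSq lam x t (x t).ofLp) / (2 * σ ^ 2)
        - Real.log (1 + invSq lam x t (x t).ofLp) / 2) + logMixture σ lam x η t := by
  have h := dotProduct_inv_mulVec_rank_one_update (posDef_covMatrix hlam x t) (x t).ofLp
    (noiseSum x η t) (η t)
  have h1 : invSq lam x (t + 1) (noiseSum x η (t + 1))
      = invSq lam x t (noiseSum x η t) + (2 * η t * noiseInner lam x η t
        + η t ^ 2 * invSq lam x t (x t).ofLp - noiseInner lam x η t ^ 2)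
        / (1 + invSq lam x t (x t).ofLp) := by
    rw [invSq, covMatrix_succ, noiseSum, Finset.sum_range_succ]
    exact h
  rw [logMixture, h1, logDetRatio_eq_sum hlam, Finset.sum_range_succ, ← logDetRatio_eq_sum hlam,
    logMixture]
  ring

section Measurability

variable {Ω : Type*} {m : MeasurableSpace Ω} {x : ℕ → Ω → Vec d} {η : ℕ → Ω → ℝ} {t : ℕ}

/-- The inverse is det⁻¹ times the adjugate: the adjugate and the determinant are continuous in the
entries, and real inversion is measurable, also at 0. -/
lemma measurable_dotProduct_inv_mulVec {M : Ω → Matrix (Fin d) (Fin d) ℝ} {u v : Ω → Fin d → ℝ}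
    (hM : ∀ i j, Measurable fun ω => M ω i j) (hu : Measurable u) (hv : Measurable v) :
    Measurable fun ω => u ω ⬝ᵥ (M ω)⁻¹ *ᵥ v ω := by
  have hF : Measurable fun p : (Fin d → Fin d → ℝ) × (Fin d → ℝ) × (Fin d → ℝ) =>
      (Matrix.of p.1).det⁻¹ * (p.2.1 ⬝ᵥ (Matrix.of p.1).adjugate *ᵥ p.2.2) := by
    have hof : Continuous fun p : (Fin d → Fin d → ℝ) × (Fin d → ℝ) × (Fin d → ℝ) =>
        Matrix.of p.1 := continuous_fst
    exact hof.matrix_det.measurable.inv.mul ((continuous_snd.fst.dotProduct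
      (hof.matrix_adjugate.matrix_mulVec continuous_snd.snd)).measurable)
  have hM' : Measurable fun ω => (fun i j => M ω i j : Fin d → Fin d → ℝ) :=
    measurable_pi_iff.2 fun i => measurable_pi_iff.2 fun j => hM i j
  convert hF.comp (hM'.prodMk (hu.prodMk hv)) using 2 with ω
  rw [Matrix.inv_def, smul_mulVec, dotProduct_smul, smul_eq_mul, Ring.inverse_eq_inv']
  rfl

lemma measurable_det {M : Ω → Matrix (Fin d) (Fin d) ℝ}
    (hM : ∀ i j, Measurable fun ω => M ω i j) : Measurable fun ω => (M ω).det := by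
  have hM' : Measurable fun ω => (fun i j => M ω i j : Fin d → Fin d → ℝ) :=
    measurable_pi_iff.2 fun i => measurable_pi_iff.2 fun j => hM i j
  have hF : Measurable fun p : Fin d → Fin d → ℝ => (Matrix.of p).det := by
    have hof : Continuous fun p : Fin d → Fin d → ℝ => Matrix.of p := continuous_id
    exact hof.matrix_det.measurable
  exact hF.comp hM'

lemma measurable_covMatrix_apply (hx : ∀ k < t, Measurable (x k)) (i j : Fin d) :
    Measurable fun ω => covMatrix lam (fun k => x k ω) t i j := by
  simp only [covMatrix, Matrix.add_apply, Matrix.sum_apply, vecMulVec_apply]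
  refine measurable_const.add (Finset.measurable_fun_sum _ fun k hk => ?_)
  have := hx k (Finset.mem_range.1 hk)
  fun_prop

lemma measurable_noiseSum (hx : ∀ k < t, Measurable (x k)) (hη : ∀ k < t, Measurable (η k)) :
    Measurable fun ω => noiseSum (fun k => x k ω) (fun k => η k ω) t := by
  simp only [noiseSum]
  refine Finset.measurable_fun_sum _ fun k hk => ?_
  have h1 := hx k (Finset.mem_range.1 hk)
  have h2 := hη k (Finset.mem_range.1 hk)
  fun_prop

lemma measurable_logMixture (σ : ℝ) (hx : ∀ k < t, Measurable (x k))
    (hη : ∀ k < t, Measurable (η k)) :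
    Measurable fun ω => logMixture σ lam (fun k => x k ω) (fun k => η k ω) t := by
  have h1 := measurable_dotProduct_inv_mulVec (measurable_covMatrix_apply (lam := lam) hx)
    (measurable_noiseSum hx hη) (measurable_noiseSum hx hη)
  have h2 := measurable_det (measurable_covMatrix_apply (lam := lam) hx)
  exact (h1.div_const _).sub ((Real.measurable_log.comp (h2.div_const _)).div_const _)

end Measurability

/-- The self-normalized deviation inequality for vector-valued sums of sub-Gaussian noise,
uniformly in time. -/
lemma measure_exists_lt_invSq_noiseSum_le {Ω : Type*} {mΩ : MeasurableSpace Ω} {μ : Measure Ω}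
    [IsProbabilityMeasure μ] {ℱ : Filtration ℕ mΩ} {η : ℕ → Ω → ℝ} {x : ℕ → Ω → Vec d} {σ δ : ℝ}
    (hσ : 0 < σ) (hlam : 0 < lam) (hδ : 0 < δ) (hη : IsSubGaussianNoise μ ℱ σ η)
    (hx : ∀ t, Measurable[ℱ t] (x t)) (hx0 : ∀ t ω, x t ω ≠ 0) :
    μ {ω | ∃ t, 2 * σ ^ 2 * (logDetRatio lam (fun k => x k ω) t / 2 + Real.log (1 / δ))
      < invSq lam (fun k => x k ω) t (noiseSum (fun k => x k ω) (fun k => η k ω) t)}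
      ≤ ENNReal.ofReal δ := by
  let Z : ℕ → Ω → ℝ := fun t ω => logMixture σ lam (fun k => x k ω) (fun k => η k ω) t
  let Y : ℕ → Ω → ℝ≥0∞ := fun t ω => ENNReal.ofReal (Real.exp (Z t ω))
  have hx' : ∀ t, ∀ k < t + 1, Measurable[ℱ t] (x k) := fun t k hk =>
    (hx k).mono (ℱ.mono (Nat.lt_succ_iff.1 hk)) le_rfl
  have hη' : ∀ t, ∀ k < t, Measurable[ℱ t] (η k) := fun t k hk =>
    (hη k).1.mono (ℱ.mono hk) le_rfl
  have hYm : ∀ t, Measurable[ℱ t] (Y t) := fun t =>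
    (Real.measurable_exp.comp (measurable_logMixture σ
      (fun k hk => hx' t k (hk.trans t.lt_succ_self)) (hη' t))).ennreal_ofReal
  have hsup : ∀ t A, MeasurableSet[ℱ t] A →
      ∫⁻ ω in A, Y (t + 1) ω ∂μ ≤ ∫⁻ ω in A, Y t ω ∂μ := by
    intro t A hA
    have hxt : ∀ k < t, Measurable[ℱ t] (x k) := fun k hk => hx' t k (hk.trans t.lt_succ_self)
    have hxof : Measurable[ℱ t] fun ω => (x t ω).ofLp :=
      (WithLp.measurable_ofLp 2 (Fin d → ℝ)).comp (hx t)
    have ha : Measurable[ℱ t] fun ω => noiseInner lam (fun k => x k ω) (fun k => η k ω) t :=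
      measurable_dotProduct_inv_mulVec (measurable_covMatrix_apply hxt) hxof
        (measurable_noiseSum hxt (hη' t))
    have hw : Measurable[ℱ t] fun ω => invSq lam (fun k => x k ω) t (x t ω).ofLp :=
      measurable_dotProduct_inv_mulVec (measurable_covMatrix_apply hxt) hxof hxof
    -- Nonzero actions keep the mixing Gaussian nondegenerate, so that it has a density.
    have hw0 : ∀ ω, 0 < invSq lam (fun k => x k ω) t (x t ω).ofLp := fun ω =>
      invSq_pos hlam _ _ (by simpa using hx0 t ω)
    have h := lintegral_exp_mixture_mul_le (ℱ.le t) hσ ((hη t).1.mono (ℱ.le _) le_rfl) (hη t).2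
      ha hw hw0 ((hYm t).indicator hA)
    rw [← lintegral_indicator (ℱ.le t _ hA), ← lintegral_indicator (ℱ.le t _ hA)]
    refine le_trans (le_of_eq (lintegral_congr fun ω => ?_)) h
    by_cases hωA : ω ∈ A
    · rw [Set.indicator_of_mem hωA, Set.indicator_of_mem hωA,
        ← ENNReal.ofReal_mul (Real.exp_nonneg _), ← Real.exp_add]
      simp only [Y, Z]
      rw [logMixture_succ hlam]
    · rw [Set.indicator_of_notMem hωA, Set.indicator_of_notMem hωA, mul_zero]
  have hville := mul_measure_exists_le_lintegral_zero hYm hsup (ENNReal.ofReal (1 / δ))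
  have hY0 : ∫⁻ ω, Y 0 ω ∂μ = 1 := by simp [Y, Z, logMixture_zero hlam]
  rw [hY0] at hville
  have hsub : {ω | ∃ t, 2 * σ ^ 2 * (logDetRatio lam (fun k => x k ω) t / 2 + Real.log (1 / δ))
      < invSq lam (fun k => x k ω) t (noiseSum (fun k => x k ω) (fun k => η k ω) t)}
      ⊆ {ω | ∃ t, ENNReal.ofReal (1 / δ) ≤ Y t ω} := by
    rintro ω ⟨t, ht⟩
    refine ⟨t, ENNReal.ofReal_le_ofReal ?_⟩
    rw [← Real.log_le_iff_le_exp (by positivity)]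
    rw [mul_comm, ← lt_div_iff₀ (by positivity)] at ht
    simp only [Z, logMixture]
    linarith
  refine (measure_mono hsub).trans ?_
  calc μ {ω | ∃ t, ENNReal.ofReal (1 / δ) ≤ Y t ω}
      = ENNReal.ofReal δ
          * (ENNReal.ofReal (1 / δ) * μ {ω | ∃ t, ENNReal.ofReal (1 / δ) ≤ Y t ω}) := by
        rw [← mul_assoc, ← ENNReal.ofReal_mul hδ.le, mul_one_div_cancel hδ.ne', ENNReal.ofReal_one,
          one_mul]
    _ ≤ ENNReal.ofReal δ * 1 := by gcongr
    _ = ENNReal.ofReal δ := mul_one _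

end SelfNormalized

/-! ### Confidence intervals for least squares. -/

section Confidence

variable {d : ℕ} {lam : ℝ}

/-- With p = V⁻¹z, V ≥ λ gives λ p·p ≤ z·p; combine with (z·p)² ≤ (z·z)(p·p) and cancel z·p. -/
lemma mul_invSq_le (hlam : 0 < lam) (x : ℕ → Vec d) (t : ℕ) (z : Fin d → ℝ) :
    lam * invSq lam x t z ≤ z ⬝ᵥ z := by
  set p := (covMatrix lam x t)⁻¹ *ᵥ z with hp
  have hVp : covMatrix lam x t *ᵥ p = z := by
    rw [hp, mulVec_mulVec, mul_nonsing_inv _ (isUnit_det_covMatrix hlam x t), one_mulVec]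
  have h0 : invSq lam x t z = z ⬝ᵥ p := rfl
  have h1 : lam * (p ⬝ᵥ p) ≤ z ⬝ᵥ p := by
    rw [← hVp, covMatrix_mulVec, add_dotProduct, smul_dotProduct, smul_eq_mul, sum_dotProduct]
    refine le_add_of_nonneg_right (Finset.sum_nonneg fun k _ => ?_)
    rw [smul_dotProduct, smul_eq_mul]
    exact mul_self_nonneg _
  have h2 : (z ⬝ᵥ p) ^ 2 ≤ (z ⬝ᵥ z) * (p ⬝ᵥ p) := by
    simpa using sq_dotProduct_mulVec_le (Matrix.PosSemidef.one (n := Fin d) (R := ℝ)) z p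
  have h3 : 0 ≤ z ⬝ᵥ z := by simpa using dotProduct_star_self_nonneg z
  have h4 : 0 ≤ z ⬝ᵥ p := h0 ▸ invSq_nonneg hlam x t z
  rw [h0]
  rcases h4.eq_or_lt with h | h
  · rw [← h, mul_zero]
    exact h3
  · refine le_of_mul_le_mul_right ?_ h
    nlinarith

/-- Since ∑ r_k x_k = Vθ - λθ + ∑ η_k x_k, the error splits into a noise term and the ridge bias. -/
lemma inner_lsEstimate_sub (hlam : 0 < lam) (x : ℕ → Vec d) (η : ℕ → ℝ) (θ z : Vec d) (t : ℕ) :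
    inner ℝ z (lsEstimate lam x (fun k => inner ℝ (x k) θ + η k) t) - inner ℝ z θ
      = z.ofLp ⬝ᵥ (covMatrix lam x t)⁻¹ *ᵥ noiseSum x η t
        - lam * (z.ofLp ⬝ᵥ (covMatrix lam x t)⁻¹ *ᵥ θ.ofLp) := by
  have h1 : ∑ k ∈ Finset.range t, (inner ℝ (x k) θ + η k) • (x k).ofLp
      = covMatrix lam x t *ᵥ θ.ofLp - lam • θ.ofLp + noiseSum x η t := by
    rw [covMatrix_mulVec, noiseSum, add_sub_cancel_left, ← Finset.sum_add_distrib]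
    simp only [inner_eq_dotProduct, add_smul]
  rw [inner_eq_dotProduct, inner_eq_dotProduct, lsEstimate, h1, mulVec_add, mulVec_sub,
    mulVec_smul, mulVec_mulVec, nonsing_inv_mul _ (isUnit_det_covMatrix hlam x t), one_mulVec,
    dotProduct_add, dotProduct_sub, dotProduct_smul, smul_eq_mul]
  ring

lemma abs_dotProduct_inv_mulVec_le (hlam : 0 < lam) (x : ℕ → Vec d) (t : ℕ) (u v : Fin d → ℝ) :
    |u ⬝ᵥ (covMatrix lam x t)⁻¹ *ᵥ v| ≤ √(invSq lam x t u) * √(invSq lam x t v) := by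
  rw [← Real.sqrt_mul (invSq_nonneg hlam x t u)]
  exact Real.abs_le_sqrt
    (sq_dotProduct_mulVec_le (posDef_covMatrix hlam x t).inv.posSemidef u v)

lemma confRadius_nonneg {σ S δ : ℝ} (hσ : 0 ≤ σ) (hS : 0 ≤ S) (x : ℕ → Vec d) (t : ℕ) :
    0 ≤ confRadius σ S lam δ x t := by
  unfold confRadius
  positivity

/-- On the event of the self-normalized inequality, the least-squares error of the value of an
action is at most `√2` times the width of its confidence interval. -/
lemma abs_inner_lsEstimate_sub_le (hlam : 0 < lam) {σ S δ : ℝ} (hσ : 0 < σ) (hδ : 0 < δ)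
    (x : ℕ → Vec d) (η : ℕ → ℝ) {θ : Vec d} (hθ : ‖θ‖ ≤ S) (z : Vec d) (t : ℕ)
    (hgood : invSq lam x t (noiseSum x η t)
      ≤ 2 * σ ^ 2 * (logDetRatio lam x t / 2 + Real.log (1 / δ))) :
    |inner ℝ z (lsEstimate lam x (fun k => inner ℝ (x k) θ + η k) t) - inner ℝ z θ|
      ≤ √2 * confRadius σ S lam δ x t * wnorm (covMatrix lam x t)⁻¹ z := by
  have hS : 0 ≤ S := (norm_nonneg θ).trans hθ
  rw [inner_lsEstimate_sub hlam, wnorm_inv_covMatrix, confRadius_eq hlam hδ]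
  have h1 : √(invSq lam x t (noiseSum x η t))
      ≤ √2 * (σ * √(logDetRatio lam x t / 2 + Real.log (1 / δ))) := by
    refine (Real.sqrt_le_sqrt hgood).trans_eq ?_
    rw [Real.sqrt_mul (by positivity), Real.sqrt_mul (by positivity), Real.sqrt_sq hσ.le, mul_assoc]
  have h2 : lam * √(invSq lam x t θ.ofLp) ≤ √lam * S := by
    have h3 : lam * √(invSq lam x t θ.ofLp) = √lam * √(lam * invSq lam x t θ.ofLp) := by
      rw [Real.sqrt_mul hlam.le, ← mul_assoc, Real.mul_self_sqrt hlam.le]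
    rw [h3]
    gcongr
    refine (Real.sqrt_le_sqrt (mul_invSq_le hlam x t _)).trans ?_
    rw [dotProduct_self_ofLp, Real.sqrt_sq (norm_nonneg θ)]
    exact hθ
  -- Only the noise term needs the factor √2; the bias is inflated to share it.
  have h2' : √lam * S ≤ √2 * (√lam * S) :=
    le_mul_of_one_le_left (by positivity) (Real.one_le_sqrt.2 (by norm_num))
  refine (abs_sub _ _).trans ?_
  rw [abs_mul, abs_of_pos hlam]
  have h4 := abs_dotProduct_inv_mulVec_le hlam x t z.ofLp (noiseSum x η t)
  have h5 := abs_dotProduct_inv_mulVec_le hlam x t z.ofLp θ.ofLp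
  have h6 := Real.sqrt_nonneg (invSq lam x t z.ofLp)
  have h7 := mul_le_mul_of_nonneg_left h1 h6
  have h8 := mul_le_mul_of_nonneg_left (h2.trans h2') h6
  have h9 := mul_le_mul_of_nonneg_left h5 hlam.le
  nlinarith

end Confidence

/-! ### From one round to the regret bound. -/

section Regret

/-- The gap of the action minimizing the ratio of optimistic gap to squared width, when values are
estimated up to `√2` times the width. The subscripts `t`, `s`, `u` refer to the action played, the
best action and the optimistic action; `G`, `n`, `e` are gaps, widths and estimation errors. -/
lemma gap_le_of_ratio_le {β N Gt Gs nt ns nu es et : ℝ} (hβ : 0 ≤ β) (hnt : 0 < nt)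
    (hns : 0 < ns) (hnu : 0 < nu) (hNu : 1 ≤ N * nu)
    (hGt : β * nt ≤ Gt) (hGs : β * ns ≤ Gs) (hu : Gt / nt ^ 2 ≤ β * nu / nu ^ 2)
    (hs : Gt / nt ^ 2 ≤ Gs / ns ^ 2) (hes : es ≤ √2 * β * ns) (het : et ≤ √2 * β * nt) :
    Gt - Gs + es + et ≤ 3 * β * N * nt ^ 2 := by
  have h2 : √2 * √2 = 2 := Real.mul_self_sqrt (by norm_num)
  have h1 : 1 ≤ √2 := Real.one_le_sqrt.2 (by norm_num)
  have h2' : √2 ≤ 2 := by nlinarith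
  have hGt0 : 0 ≤ Gt := (by positivity : 0 ≤ β * nt).trans hGt
  -- The optimistic action has gap exactly β nu, so its ratio is β / nu ≤ β N.
  have hA : Gt ≤ β * N * nt ^ 2 := by
    rw [div_le_div_iff₀ (by positivity) (by positivity)] at hu
    have h : Gt * nu ≤ β * nt ^ 2 := by
      refine le_of_mul_le_mul_right ?_ hnu
      linarith
    have hN : 0 ≤ N := by
      by_contra hN
      nlinarith [mul_neg_of_neg_of_pos (not_le.1 hN) hnu]
    nlinarith [mul_le_mul_of_nonneg_left hNu hGt0, mul_le_mul_of_nonneg_left h hN]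
  have hB : β * nt ≤ β * N * nt ^ 2 := hGt.trans hA
  -- In this case Gs absorbs the error es, i.e. optimism holds for the best action; what remains is
  -- Gt + √2 β nt.
  by_cases hc : √2 * β * ns ≤ Gs
  · nlinarith [mul_le_mul_of_nonneg_right h2' (mul_nonneg hβ hnt.le)]
  · push Not at hc
    have hβ' : 0 < β := by
      rcases hβ.eq_or_lt with h | h
      · rw [← h] at hc hGs
        linarith
      · exact h
    -- Here β / nt ≤ Gt / nt² ≤ Gs / ns² < √2 β / ns. The optimism deficit is then at most (√2 - 1)
    -- β ns ≤ (2 - √2) β nt, and adding et gives at most Gt + 2 β nt.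
    have hw : ns ≤ √2 * nt := by
      rw [div_le_div_iff₀ (by positivity) (by positivity)] at hs
      have h3 : β * nt * ns ^ 2 < √2 * β * ns * nt ^ 2 := by
        calc β * nt * ns ^ 2 ≤ Gt * ns ^ 2 := by gcongr
          _ ≤ Gs * nt ^ 2 := hs
          _ < _ := by gcongr
      have h4 : (β * nt * ns) * ns < (β * nt * ns) * (√2 * nt) := by linarith
      exact (lt_of_mul_lt_mul_left h4 (by positivity)).le
    have h5 : (√2 - 1) * β * ns ≤ (√2 - 1) * β * (√2 * nt) :=
      mul_le_mul_of_nonneg_left hw (mul_nonneg (by linarith) hβ)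
    nlinarith

lemma le_two_mul_log_one_add {w : ℝ} (hw0 : 0 ≤ w) (hw : w ≤ 1) : w ≤ 2 * Real.log (1 + w) := by
  have h := Real.one_sub_inv_le_log_of_pos (show 0 < 1 + w by linarith)
  have h1 : 1 - (1 + w)⁻¹ = w / (1 + w) := by field_simp; ring
  have h2 : w / 2 ≤ w / (1 + w) := by gcongr; linarith
  linarith

variable {d : ℕ} {lam : ℝ}

lemma abs_inner_le_of_norm_eq_one {z θ : Vec d} {S : ℝ} (hz : ‖z‖ = 1) (hθ : ‖θ‖ ≤ S) :
    |inner ℝ z θ| ≤ S := by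
  refine (abs_real_inner_le_norm z θ).trans ?_
  rwa [hz, one_mul]

lemma regret_le_two_mul {S : ℝ} {θ : Vec d} (hθ : ‖θ‖ ≤ S) {x xstar : ℕ → Vec d}
    (hx : ∀ t, ‖x t‖ = 1) (hxs : ∀ t, ‖xstar t‖ = 1) (T : ℕ) :
    regret θ xstar x T ≤ 2 * S * T := by
  rw [regret]
  refine (Finset.sum_le_card_nsmul _ _ (2 * S) fun t _ => ?_).trans_eq (by simp [mul_comm])
  have h1 := (abs_le.1 (abs_inner_le_of_norm_eq_one (hx t) hθ)).1
  have h2 := (abs_le.1 (abs_inner_le_of_norm_eq_one (hxs t) hθ)).2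
  linarith

/-- The instantaneous regret of regret balancing on the good event. -/
lemma inner_sub_inner_le {σ S δ : ℝ} (hσ : 0 < σ) (hlam : 0 < lam) (hδ : 0 < δ)
    {θ : Vec d} (hθ : ‖θ‖ ≤ S) {D : ℕ → Set (Vec d)} (hD : ∀ t, D t ⊆ Metric.sphere 0 1)
    {x xstar : ℕ → Vec d} {η : ℕ → ℝ}
    (hplay : IsRegretBalancing σ S lam δ D x (fun t => inner ℝ (x t) θ + η t))
    (hxs : ∀ t, xstar t ∈ D t) (t : ℕ)
    (hgood : invSq lam x t (noiseSum x η t)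
      ≤ 2 * σ ^ 2 * (logDetRatio lam x t / 2 + Real.log (1 / δ))) :
    inner ℝ (xstar t) θ - inner ℝ (x t) θ
      ≤ 3 * confRadius σ S lam δ x t * √(lam + t) * invSq lam x t (x t).ofLp := by
  obtain ⟨hxt, u, hu, hmax, hmin⟩ := hplay t
  have hS : 0 ≤ S := (norm_nonneg θ).trans hθ
  have hnorm : ∀ t z, z ∈ D t → ‖z‖ = 1 := fun t z hz => by simpa using hD t hz
  have hx1 : ∀ t, ‖x t‖ = 1 := fun t => hnorm t _ (hplay t).1
  have hne : ∀ z ∈ D t, z.ofLp ≠ 0 := fun z hz h => by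
    have h0 : z = 0 := by simpa using h
    simpa [h0] using hnorm t z hz
  set r : ℕ → ℝ := fun t => inner ℝ (x t) θ + η t with hr
  set β := confRadius σ S lam δ x t
  set W : Vec d → ℝ := wnorm (covMatrix lam x t)⁻¹ with hW
  have hWpos : ∀ z ∈ D t, 0 < W z := fun z hz =>
    Real.sqrt_pos.2 (invSq_pos hlam x t (hne z hz))
  have hWone : ∀ z ∈ D t, 1 ≤ √(lam + t) * W z := fun z hz => by
    rw [hW, wnorm_inv_covMatrix, ← Real.sqrt_mul (by positivity), Real.one_le_sqrt]
    exact one_le_mul_invSq hlam hx1 t (hnorm t z hz)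
  have hmax' : ∀ z ∈ D t, inner ℝ z (lsEstimate lam x r t) + β * W z
      ≤ ucbValue σ S lam δ x r t u := fun z hz => hmax hz
  have herr : ∀ z, |inner ℝ z (lsEstimate lam x r t) - inner ℝ z θ| ≤ √2 * β * W z := fun z =>
    abs_inner_lsEstimate_sub_le hlam hσ hδ x η hθ z t hgood
  set b := ucbValue σ S lam δ x r t u with hb
  have hb' : b - inner ℝ u (lsEstimate lam x r t) = β * W u := by
    rw [hb, ucbValue, add_sub_cancel_left]
  have hratio : ∀ z ∈ D t, (b - inner ℝ (x t) (lsEstimate lam x r t)) / W (x t) ^ 2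
      ≤ (b - inner ℝ z (lsEstimate lam x r t)) / W z ^ 2 := fun z hz => hmin hz
  have hWsq : W (x t) ^ 2 = invSq lam x t (x t).ofLp := by
    rw [hW, wnorm_inv_covMatrix, Real.sq_sqrt (invSq_nonneg hlam x t _)]
  have h := gap_le_of_ratio_le (N := √(lam + t)) (Gt := b - inner ℝ (x t) (lsEstimate lam x r t))
    (Gs := b - inner ℝ (xstar t) (lsEstimate lam x r t))
    (es := inner ℝ (xstar t) θ - inner ℝ (xstar t) (lsEstimate lam x r t))
    (et := inner ℝ (x t) (lsEstimate lam x r t) - inner ℝ (x t) θ)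
    (confRadius_nonneg hσ.le hS x t) (hWpos _ hxt)
    (hWpos _ (hxs t)) (hWpos u hu) (hWone u hu)
    (by linarith [hmax' _ hxt]) (by linarith [hmax' _ (hxs t)])
    (by simpa only [hb'] using hratio u hu) (hratio _ (hxs t))
    (by linarith [(abs_le.1 (herr (xstar t))).1]) (by linarith [(abs_le.1 (herr (x t))).2])
  rw [← hWsq]
  linarith

/-- The regret bound on the good event, in terms of the horizon. -/
lemma regret_le_mul_log {σ S δ : ℝ} (hσ : 0 < σ) (hlam : 0 < lam) (hδ : 0 < δ)
    {θ : Vec d} (hθ : ‖θ‖ ≤ S) {D : ℕ → Set (Vec d)} (hD : ∀ t, D t ⊆ Metric.sphere 0 1)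
    {x xstar : ℕ → Vec d} {η : ℕ → ℝ}
    (hplay : IsRegretBalancing σ S lam δ D x (fun t => inner ℝ (x t) θ + η t))
    (hxs : ∀ t, xstar t ∈ D t)
    (hgood : ∀ t, invSq lam x t (noiseSum x η t)
      ≤ 2 * σ ^ 2 * (logDetRatio lam x t / 2 + Real.log (1 / δ))) (T : ℕ) :
    regret θ xstar x T ≤ 2 * (d * Real.log (1 + T / lam)) * (2 * S
      + 3 * (σ * √(d * Real.log (1 + T / lam) / 2 + Real.log (1 / δ)) + √lam * S)
        * √(lam + T)) := by
  have hS : 0 ≤ S := (norm_nonneg θ).trans hθ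
  have hnorm : ∀ t z, z ∈ D t → ‖z‖ = 1 := fun t z hz => by simpa using hD t hz
  have hx1 : ∀ t, ‖x t‖ = 1 := fun t => hnorm t _ (hplay t).1
  set B := σ * √(d * Real.log (1 + T / lam) / 2 + Real.log (1 / δ)) + √lam * S with hB
  set K := 2 * S + 3 * B * √(lam + T) with hK
  have hB0 : 0 ≤ B := by positivity
  have hlogT := logDetRatio_le hlam hx1 T
  have hround : ∀ t ∈ Finset.range T, inner ℝ (xstar t) θ - inner ℝ (x t) θ
      ≤ Real.log (1 + invSq lam x t (x t).ofLp) * (2 * K) := by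
    intro t ht
    have htT := (Finset.mem_range.1 ht).le
    have hw := invSq_nonneg hlam x t (x t).ofLp
    set w := invSq lam x t (x t).ofLp with hwdef
    -- Wide rounds, w ≥ 1, escape the comparison of w with log(1+w). Each costs at most 2S, paid for
    -- by 2 log(1+w) ≥ 2 log 2 ≥ 1; hence the 2S in K.
    rcases le_total w 1 with hw1 | hw1
    · have hβ : confRadius σ S lam δ x t ≤ B := by
        rw [confRadius_eq hlam hδ, hB]
        have := (logDetRatio_mono hlam x htT).trans hlogT
        gcongr
      have hlog := le_two_mul_log_one_add hw hw1
      calc inner ℝ (xstar t) θ - inner ℝ (x t) θ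
          ≤ 3 * confRadius σ S lam δ x t * √(lam + t) * w :=
            inner_sub_inner_le hσ hlam hδ hθ hD hplay hxs t (hgood t)
        _ ≤ 3 * B * √(lam + T) * w := by gcongr
        _ ≤ K * w := by
            gcongr
            linarith
        _ ≤ K * (2 * Real.log (1 + w)) := by gcongr
        _ = _ := by ring
    · have h1 := (abs_le.1 (abs_inner_le_of_norm_eq_one (hx1 t) hθ)).1
      have h2 := (abs_le.1 (abs_inner_le_of_norm_eq_one (hnorm t _ (hxs t)) hθ)).2
      have h3 : 1 ≤ 2 * Real.log (1 + w) := by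
        have := Real.log_le_log (by norm_num : (0 : ℝ) < 2) (show 2 ≤ 1 + w by linarith)
        linarith [Real.log_two_gt_d9]
      calc inner ℝ (xstar t) θ - inner ℝ (x t) θ ≤ K * 1 := by
            rw [mul_one, hK]
            have : 0 ≤ 3 * B * √(lam + T) := by positivity
            linarith
        _ ≤ K * (2 * Real.log (1 + w)) := by gcongr
        _ = _ := by ring
  rw [regret]
  refine (Finset.sum_le_sum hround).trans ?_
  rw [← Finset.sum_mul, ← logDetRatio_eq_sum hlam]
  have hK0 : 0 ≤ 2 * K := by positivity
  calc logDetRatio lam x T * (2 * K) ≤ d * Real.log (1 + T / lam) * (2 * K) := by gcongr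
    _ = _ := by ring

/-- The explicit form of the regret bound on the good event. -/
lemma regret_le_of_forall_invSq_noiseSum_le {σ S δ : ℝ} (hσ : 0 < σ) (hlam : 0 < lam)
    (hδ : 0 < δ) (hδ1 : δ < 1)
    {θ : Vec d} (hθ : ‖θ‖ ≤ S) {D : ℕ → Set (Vec d)} (hD : ∀ t, D t ⊆ Metric.sphere 0 1)
    {x xstar : ℕ → Vec d} {η : ℕ → ℝ}
    (hplay : IsRegretBalancing σ S lam δ D x (fun t => inner ℝ (x t) θ + η t))
    (hxs : ∀ t, xstar t ∈ D t)
    (hgood : ∀ t, invSq lam x t (noiseSum x η t)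
      ≤ 2 * σ ^ 2 * (logDetRatio lam x t / 2 + Real.log (1 / δ))) (T : ℕ) :
    regret θ xstar x T ≤ 24 * (σ + (1 + √lam) * S) * (d : ℝ) ^ (3 / 2 : ℝ) * √(T : ℝ)
      * Real.log (2 + T + d + 1 / lam + 1 / δ) ^ 2 := by
  have hS : 0 ≤ S := (norm_nonneg θ).trans hθ
  have hnorm : ∀ t z, z ∈ D t → ‖z‖ = 1 := fun t z hz => by simpa using hD t hz
  have hx1 : ∀ t, ‖x t‖ = 1 := fun t => hnorm t _ (hplay t).1
  rcases Nat.eq_zero_or_pos T with rfl | hT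
  · simp [regret]
  -- Dimension 0 has no unit vector to play.
  have hd : 1 ≤ d := by
    rcases Nat.eq_zero_or_pos d with rfl | h
    · have := hx1 0
      rw [Subsingleton.elim (x 0) 0] at this
      simp at this
    · exact h
  have hd' : (1 : ℝ) ≤ d := by exact_mod_cast hd
  have hT' : (1 : ℝ) ≤ T := by exact_mod_cast hT
  have hδ' : 1 < 1 / δ := by rw [lt_div_iff₀ hδ]; linarith
  have hlam' : 0 < 1 / lam := by positivity
  set A := 2 + (T : ℝ) + d + 1 / lam + 1 / δ with hA
  set L := Real.log A with hL
  have hL1 : 1 ≤ L := by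
    rw [hL, Real.le_log_iff_exp_le (by linarith)]
    linarith [Real.exp_one_lt_d9]
  have hd32 : (d : ℝ) ^ (3 / 2 : ℝ) = d * √d := by
    rw [show (3 / 2 : ℝ) = 1 + 1 / 2 by norm_num, Real.rpow_add (by linarith), Real.rpow_one,
      Real.sqrt_eq_rpow]
  have hsd : 1 ≤ √(d : ℝ) := Real.one_le_sqrt.2 hd'
  have hsT : 1 ≤ √(T : ℝ) := Real.one_le_sqrt.2 hT'
  rw [hd32]
  -- For λ ≤ T, √(λ+T) is of order √T. For λ ≥ T, the trivial bound 2ST ≤ 2S√λ√T suffices, thanks to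
  -- the √λ S in the prefactor.
  rcases le_total lam T with hle | hle
  · have hlog1 : Real.log (1 + T / lam) ≤ 2 * L := by
      rw [hL, ← Real.log_rpow (by linarith) 2]
      refine Real.log_le_log (by positivity) ?_
      rw [Real.rpow_two, div_eq_mul_one_div]
      nlinarith
    have hlog2 : Real.log (1 / δ) ≤ L := Real.log_le_log (by linarith) (by linarith)
    have hlog0 : 0 ≤ Real.log (1 + T / lam) :=
      Real.log_nonneg (le_add_of_nonneg_right (by positivity))
    have hs2 : √2 * √2 = 2 := Real.mul_self_sqrt (by norm_num)
    have hs2' : √2 ≤ 2 := by nlinarith [Real.sqrt_nonneg 2]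
    have hrad : √(d * Real.log (1 + T / lam) / 2 + Real.log (1 / δ)) ≤ √2 * √d * L := by
      rw [Real.sqrt_le_left (by positivity), mul_pow, mul_pow, Real.sq_sqrt (by norm_num),
        Real.sq_sqrt (by linarith)]
      have h1 := mul_le_mul_of_nonneg_left hlog1 (by linarith : (0 : ℝ) ≤ d)
      have h2 : L ≤ L ^ 2 := by nlinarith
      have h3 : L ≤ d * L := by nlinarith
      have h4 : d * L ≤ d * L ^ 2 := by gcongr
      linarith
    have hsum : √(lam + T) ≤ √2 * √T := by
      rw [← Real.sqrt_mul (by norm_num)]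
      exact Real.sqrt_le_sqrt (by linarith)
    have hK : 2 * S + 3 * (σ * √(d * Real.log (1 + T / lam) / 2 + Real.log (1 / δ)) + √lam * S)
        * √(lam + T) ≤ √d * √T * L * (6 * (σ + (1 + √lam) * S)) := by
      have hP : 1 ≤ √d * √T * L :=
        one_le_mul_of_one_le_of_one_le (one_le_mul_of_one_le_of_one_le hsd hsT) hL1
      have hP' : √T ≤ √d * √T * L := by
        have : 1 ≤ √d * L := one_le_mul_of_one_le_of_one_le hsd hL1
        nlinarith
      calc _ ≤ 2 * S + 3 * (σ * (√2 * √d * L) + √lam * S) * (√2 * √T) := by gcongr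
        _ = 2 * S + 3 * (√2 * √2) * σ * (√d * √T * L) + 3 * √2 * (√lam * S) * √T := by ring
        _ ≤ 2 * S * (√d * √T * L) + 3 * 2 * σ * (√d * √T * L)
            + 3 * 2 * (√lam * S) * (√d * √T * L) := by
          rw [hs2]
          have h1 : 2 * S ≤ 2 * S * (√d * √T * L) := le_mul_of_one_le_right (by positivity) hP
          gcongr
        _ ≤ _ := by
          have : 0 ≤ S * (√d * √T * L) := by positivity
          linarith
    refine (regret_le_mul_log hσ hlam hδ hθ hD hplay hxs hgood T).trans ?_
    -- The constant is 24 = 2 · 2 · 6, and each of the two factors contributes one L.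
    calc _ ≤ 2 * (d * (2 * L)) * (√d * √T * L * (6 * (σ + (1 + √lam) * S))) := by gcongr
      _ = _ := by ring
  · refine (regret_le_two_mul hθ hx1 (fun t => hnorm t _ (hxs t)) T).trans ?_
    have h1 : (T : ℝ) ≤ √lam * √T := by
      rw [← Real.sqrt_mul hlam.le]
      refine Real.le_sqrt_of_sq_le ?_
      rw [sq]
      gcongr
    have hP : 1 ≤ d * √d * L ^ 2 :=
      one_le_mul_of_one_le_of_one_le (one_le_mul_of_one_le_of_one_le hd' hsd) (one_le_pow₀ hL1)
    calc 2 * S * T ≤ 24 * S * (√lam * √T) := by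
          gcongr
          norm_num
      _ ≤ 24 * (σ + (1 + √lam) * S) * √T := by
          have : 0 ≤ σ * √T + S * √T := by positivity
          linarith
      _ ≤ 24 * (σ + (1 + √lam) * S) * √T * (d * √d * L ^ 2) :=
          le_mul_of_one_le_right (by positivity) hP
      _ = _ := by ring

end Regret

end LinearBandit

theorem mainTheorem4 :
    ∃ C > (0 : ℝ), ∃ k : ℕ,
      ∀ (d : ℕ) (σ S lam δ : ℝ), 0 < σ → 0 < lam → 0 < δ → δ < 1 →
      ∀ (θ : LinearBandit.Vec d), ‖θ‖ ≤ S →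
      ∀ (Ω : Type*) (mΩ : MeasurableSpace Ω) (μ : Measure Ω), IsProbabilityMeasure μ →
      ∀ (ℱ : Filtration ℕ mΩ)
        -- noise, decision sets, actions and optimal actions, round by round
        (η : ℕ → Ω → ℝ) (D : ℕ → Ω → Set (LinearBandit.Vec d))
        (x xstar : ℕ → Ω → LinearBandit.Vec d),
        LinearBandit.IsSubGaussianNoise μ ℱ σ η →
        (∀ t ω, D t ω ⊆ Metric.sphere 0 1) →
        (∀ t, Measurable[ℱ t] (x t)) →
        (∀ ω, LinearBandit.IsRegretBalancing σ S lam δ (fun t => D t ω) (fun t => x t ω)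
          (fun t => inner ℝ (x t ω) θ + η t ω)) →
        (∀ t ω, xstar t ω ∈ D t ω ∧ IsMaxOn (fun z => inner ℝ z θ) (D t ω) (xstar t ω)) →
        -- the bound fails for some horizon `T` with probability at most `δ`
        μ {ω | ∃ T : ℕ,
            C * (σ + (1 + √lam) * S) * (d : ℝ) ^ (3 / 2 : ℝ) * √(T : ℝ)
                * Real.log (2 + T + d + 1 / lam + 1 / δ) ^ k
              < LinearBandit.regret θ (fun t => xstar t ω) (fun t => x t ω) T}
          ≤ ENNReal.ofReal δ := by
  refine ⟨24, by norm_num, 2, ?_⟩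
  intro d σ S lam δ hσ hlam hδ hδ1 θ hθ Ω mΩ μ hμ ℱ η D x xstar hη hD hx hplay hxs
  have hx0 : ∀ t ω, x t ω ≠ 0 := fun t ω h => by
    have := hD t ω (hplay ω t).1
    simp [h] at this
  -- Failure at any horizon forces the deviation event. Only monotonicity of μ is used, so the
  -- failure event need not be measurable.
  refine le_trans (measure_mono ?_)
    (LinearBandit.measure_exists_lt_invSq_noiseSum_le hσ hlam hδ hη hx hx0)
  rintro ω ⟨T, hT⟩
  by_contra hgood
  refine absurd hT (not_lt.2 ?_)
  refine LinearBandit.regret_le_of_forall_invSq_noiseSum_le hσ hlam hδ hδ1 hθ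
    (fun t => hD t ω) (hplay ω) (fun t => (hxs t ω).1) (fun t => ?_) T
  by_contra hlt
  exact hgood ⟨t, not_le.1 hlt⟩
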